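/- Let $n\ge 3$. Let $h:\mathbb R^n\to[0,\infty)$ be continuous with $h\in L^1(\mathbb R^n)\cap L^\infty(\mathbb R^n)$, and let $g:\mathbb R^n\times\mathbb R\to\mathbb R$ be continuous and satisfy the growth bound $|g(x,t)|\le Z(x)$ for all $(x,t)\in\mathbb R^n\times\mathbb R$, for some $Z\in L^1(\mathbb R^n)\cap L^\infty(\mathbb R^n)$ with $Z(x)>0$ for all $x$. Put $G(x,s)=\int_0^s g(x,\tau)\,d\tau$. Equip the Sobolev space $H^1(\mathbb R^n)$ with the norm $\|u\|=\left(\int_{\mathbb R^n}(|\nabla u|^2+|u|^2)\,dx\right)^{1/2}$. For $\mu\in\mathbb R$ let $N_\mu$ be the space of weak solutions $u\in H^1(\mathbb R^n)$ of $-\Delta u+u=\mu h(x)u$, that is, of those $u$ with $\int(\nabla u\cdot\nabla\varphi+u\varphi)\,dx=\mu\int u\varphi h\,dx$ for all $\varphi\in H^1(\mathbb R^n)$; $\mu$ is an eigenvalue if $N_\mu\ne\{0\}$. Let $\lambda_1<\lambda_2<\cdots$ be the distinct eigenvalues, let $\lambda_k$ be the $k$-th one, and put $$X_-=N_{\lambda_1}\oplus\cdots\oplus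 N_{\lambda_{k-1}},\qquad X_0=N_{\lambda_k},\qquad X_+=\overline{\bigoplus_{j>k}N_{\lambda_j}},$$ with the closure taken in $H^1(\mathbb R^n)$ (so $X_-=\{0\}$ if $k=1$). Define $\Phi:H^1(\mathbb R^n)\to\mathbb R$ by $$\Phi(u)=\frac12\int_{\mathbb R^n}(|\nabla u|^2+|u|^2)\,dx-\frac{\lambda_k}{2}\int_{\mathbb R^n}u^2h\,dx-\int_{\mathbb R^n}G(x,u(x))\,dx .$$ 1. Suppose $(g_2^-)$: $\int_{\mathbb R^n}G(x,v(x))\,dx\to-\infty$ as $\|v\|\to\infty$, $v\in N_{\lambda_k}$. Then (a) $\Phi(u)\to-\infty$ as $\|u\|\to\infty$, $u\in X_-$; and (b) $\Phi(u)\to+\infty$ as $\|u\|\to\infty$, $u\in X_0\oplus X_+$. 2. Suppose instead $(g_2^+)$: $\int_{\mathbb R^n}G(x,v(x))\,dx\to+\infty$ as $\|v\|\to\infty$, $v\in N_{\lambda_k}$. Then (a) $\Phi(u)\to-\infty$ as $\|u\|\to\infty$, $u\in X_0\oplus X_-$; and (b) $\Phi(u)\to+\infty$ as $\|u\|\to\infty$,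 $u\in X_+$. -/

import Mathlib

open MeasureTheory Filter Topology
open scoped ContDiff

noncomputable section

namespace Resonance

/-- The Euclidean space `ℝⁿ`, with its Euclidean norm and Lebesgue measure. -/
abbrev Rn (n : ℕ) : Type := EuclideanSpace ℝ (Fin n)

/-- The Hilbert space `L²(ℝⁿ) × L²(ℝⁿ; ℝⁿ)`, with `‖(u, w)‖² = ‖u‖² + ‖w‖²`. -/
abbrev L2Pair (n : ℕ) : Type :=
  WithLp 2 (Lp ℝ 2 (volume : Measure (Rn n)) × Lp (Rn n) 2 (volume : Measure (Rn n)))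

/-- `w` is the weak gradient of `u`: for every test function `φ ∈ C_c^∞(ℝⁿ)` and every `i`,
`∫ u ∂ᵢφ = - ∫ wᵢ φ`. -/
def IsWeakGradient {n : ℕ} (u : Rn n → ℝ) (w : Rn n → Rn n) : Prop :=
  ∀ φ : Rn n → ℝ, ContDiff ℝ ∞ φ → HasCompactSupport φ → ∀ i : Fin n,
    ∫ x, u x * fderiv ℝ φ x (EuclideanSpace.single i 1) = - ∫ x, w x i * φ x

theorem integrable_mul_fderiv {n : ℕ} (u : Lp ℝ 2 (volume : Measure (Rn n)))
    {φ : Rn n → ℝ} (hφ : ContDiff ℝ ∞ φ) (hc : HasCompactSupport φ) (v : Rn n) :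
    Integrable (fun x => u x * fderiv ℝ φ x v) := by
  have h1 : Continuous (fun x => fderiv ℝ φ x v) :=
    (hφ.continuous_fderiv (by simp)).clm_apply continuous_const
  have h2 : HasCompactSupport (fun x => fderiv ℝ φ x v) := hc.fderiv_apply ℝ v
  have h3 : MemLp (fun x => fderiv ℝ φ x v) 2 (volume : Measure (Rn n)) :=
    h1.memLp_of_hasCompactSupport h2
  exact (Lp.memLp u).integrable_mul h3

theorem integrable_coord_mul {n : ℕ} (w : Lp (Rn n) 2 (volume : Measure (Rn n)))
    {φ : Rn n → ℝ} (hφ : ContDiff ℝ ∞ φ) (hc : HasCompactSupport φ) (i : Fin n) :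
    Integrable (fun x => w x i * φ x) := by
  have h1 : MemLp (fun x => w x i) 2 :=
    (EuclideanSpace.proj i : Rn n →L[ℝ] ℝ).comp_memLp' (Lp.memLp w)
  have h2 : MemLp φ 2 (volume : Measure (Rn n)) :=
    hφ.continuous.memLp_of_hasCompactSupport hc
  exact h1.integrable_mul h2

/-- The Sobolev space `H¹(ℝⁿ)`: the `u ∈ L²` that have a weak gradient `∇u ∈ L²`. An element is
stored as the pair `(u, ∇u)` (the weak gradient is determined by `u`), so that the inherited
inner product is `∫ (∇u · ∇v + u v)` and the norm is `(∫ (|∇u|² + |u|²))^{1/2}`. -/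
def H1 (n : ℕ) : Submodule ℝ (L2Pair n) where
  carrier := {p | IsWeakGradient (p.fst : Rn n → ℝ) (p.snd : Rn n → Rn n)}
  zero_mem' := by
    intro φ _ _ i
    have h1 : ∫ x, ((0 : L2Pair n).fst : Rn n → ℝ) x *
        fderiv ℝ φ x (EuclideanSpace.single i 1) = 0 := by
      apply integral_eq_zero_of_ae
      filter_upwards [Lp.coeFn_zero ℝ 2 (volume : Measure (Rn n))] with x hx
      rw [WithLp.zero_fst, hx]
      simp
    have h2 : ∫ x, ((0 : L2Pair n).snd : Rn n → Rn n) x i * φ x = 0 := by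
      apply integral_eq_zero_of_ae
      filter_upwards [Lp.coeFn_zero (Rn n) 2 (volume : Measure (Rn n))] with x hx
      rw [WithLp.zero_snd, hx]
      simp
    rw [h1, h2, neg_zero]
  add_mem' := by
    intro p q hp hq φ hφ hc i
    have h1 : ∫ x, ((p + q).fst : Rn n → ℝ) x * fderiv ℝ φ x (EuclideanSpace.single i 1)
        = ∫ x, ((p.fst : Rn n → ℝ) x * fderiv ℝ φ x (EuclideanSpace.single i 1)
          + (q.fst : Rn n → ℝ) x * fderiv ℝ φ x (EuclideanSpace.single i 1)) := by
      apply integral_congr_ae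
      filter_upwards [Lp.coeFn_add p.fst q.fst] with x hx
      rw [WithLp.add_fst, hx]
      simp only [Pi.add_apply, add_mul]
    have h2 : ∫ x, ((p + q).snd : Rn n → Rn n) x i * φ x
        = ∫ x, ((p.snd : Rn n → Rn n) x i * φ x + (q.snd : Rn n → Rn n) x i * φ x) := by
      apply integral_congr_ae
      filter_upwards [Lp.coeFn_add p.snd q.snd] with x hx
      rw [WithLp.add_snd, hx]
      simp only [Pi.add_apply, PiLp.add_apply, add_mul]
    rw [h1, h2, integral_add (integrable_mul_fderiv _ hφ hc _) (integrable_mul_fderiv _ hφ hc _),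
      integral_add (integrable_coord_mul _ hφ hc _) (integrable_coord_mul _ hφ hc _),
      hp φ hφ hc i, hq φ hφ hc i, neg_add]
  smul_mem' := by
    intro c p hp φ hφ hc i
    have h1 : ∫ x, ((c • p).fst : Rn n → ℝ) x * fderiv ℝ φ x (EuclideanSpace.single i 1)
        = ∫ x, c * ((p.fst : Rn n → ℝ) x * fderiv ℝ φ x (EuclideanSpace.single i 1)) := by
      apply integral_congr_ae
      filter_upwards [Lp.coeFn_smul c p.fst] with x hx
      rw [WithLp.smul_fst, hx]
      simp only [Pi.smul_apply, smul_eq_mul, mul_assoc]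
    have h2 : ∫ x, ((c • p).snd : Rn n → Rn n) x i * φ x
        = ∫ x, c * ((p.snd : Rn n → Rn n) x i * φ x) := by
      apply integral_congr_ae
      filter_upwards [Lp.coeFn_smul c p.snd] with x hx
      rw [WithLp.smul_snd, hx]
      simp only [Pi.smul_apply, PiLp.smul_apply, smul_eq_mul, mul_assoc]
    rw [h1, h2, integral_const_mul, integral_const_mul, hp φ hφ hc i, mul_neg]

/-- The function `u` underlying an element of `H¹(ℝⁿ)`. -/
def fn {n : ℕ} (u : H1 n) : Lp ℝ 2 (volume : Measure (Rn n)) := (u : L2Pair n).fst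

/-- The weak gradient `∇u` of an element of `H¹(ℝⁿ)`. -/
def grad {n : ℕ} (u : H1 n) : Lp (Rn n) 2 (volume : Measure (Rn n)) := (u : L2Pair n).snd

/-- The `H¹` inner product is `∫ (∇u · ∇v + u v)`. -/
theorem inner_eq {n : ℕ} (u v : H1 n) :
    ∫ x, (inner ℝ (grad u x) (grad v x) + fn u x * fn v x) = inner ℝ u v := by
  have h1 : Integrable (fun x => fn u x * fn v x) :=
    (Lp.memLp (fn u)).integrable_mul (Lp.memLp (fn v))
  have h2 : Integrable (fun x => inner ℝ (grad u x) (grad v x)) :=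
    L2.integrable_inner (𝕜 := ℝ) (grad u) (grad v)
  rw [integral_add h2 h1, Submodule.coe_inner, WithLp.prod_inner_apply, L2.inner_def, L2.inner_def,
    add_comm]
  simp [fn, grad, mul_comm]

/-- The assumptions on the weight `h`: continuous, nonnegative, in `L¹ ∩ L^∞`. -/
structure IsWeight {n : ℕ} (h : Rn n → ℝ) : Prop where
  continuous : Continuous h
  nonneg : ∀ x, 0 ≤ h x
  memLp_one : MemLp h 1 (volume : Measure (Rn n))
  memLp_top : MemLp h ⊤ (volume : Measure (Rn n))

theorem IsWeight.integrable {n : ℕ} {h : Rn n → ℝ} (hh : IsWeight h) (u v : H1 n) :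
    Integrable (fun x => fn u x * fn v x * h x) :=
  ((Lp.memLp (fn u)).integrable_mul (Lp.memLp (fn v))).mul_of_top_left hh.memLp_top

/-- `N_μ`: the space of weak solutions `u ∈ H¹(ℝⁿ)` of `-Δu + u = μ h u`, that is,
`∫ (∇u · ∇φ + u φ) = μ ∫ u φ h` for all `φ ∈ H¹(ℝⁿ)`. -/
def eigenspace {n : ℕ} {h : Rn n → ℝ} (hh : IsWeight h) (μ : ℝ) : Submodule ℝ (H1 n) where
  carrier := {u | ∀ φ : H1 n,
    ∫ x, (inner ℝ (grad u x) (grad φ x) + fn u x * fn φ x) = μ * ∫ x, fn u x * fn φ x * h x}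
  zero_mem' := by
    intro φ
    have h1 : ∫ x, fn (0 : H1 n) x * fn φ x * h x = 0 := by
      apply integral_eq_zero_of_ae
      filter_upwards [Lp.coeFn_zero ℝ 2 (volume : Measure (Rn n))] with x hx
      have : fn (0 : H1 n) = 0 := rfl
      rw [this, hx]
      simp
    rw [inner_eq, h1, inner_zero_left, mul_zero]
  add_mem' := by
    intro u v hu hv φ
    have h1 : ∫ x, fn (u + v) x * fn φ x * h x
        = ∫ x, (fn u x * fn φ x * h x + fn v x * fn φ x * h x) := by
      apply integral_congr_ae
      filter_upwards [Lp.coeFn_add (fn u) (fn v)] with x hx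
      have : fn (u + v) = fn u + fn v := rfl
      rw [this, hx]
      simp only [Pi.add_apply, add_mul]
    rw [inner_eq, h1, integral_add (hh.integrable _ _) (hh.integrable _ _), inner_add_left,
      mul_add, ← hu φ, ← hv φ, inner_eq, inner_eq]
  smul_mem' := by
    intro c u hu φ
    have h1 : ∫ x, fn (c • u) x * fn φ x * h x = ∫ x, c * (fn u x * fn φ x * h x) := by
      apply integral_congr_ae
      filter_upwards [Lp.coeFn_smul c (fn u)] with x hx
      have : fn (c • u) = c • fn u := rfl
      rw [this, hx]
      simp only [Pi.smul_apply, smul_eq_mul, mul_assoc]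
    rw [inner_eq, h1, integral_const_mul, real_inner_smul_left, mul_left_comm, ← hu φ,
      inner_eq]

/-- `μ` is an eigenvalue of `-Δu + u = μ h u`, `u ∈ H¹(ℝⁿ)`. -/
def IsEigenvalue {n : ℕ} {h : Rn n → ℝ} (hh : IsWeight h) (μ : ℝ) : Prop :=
  eigenspace hh μ ≠ ⊥

/-- `lam` is the `k`-th eigenvalue `λ_k` in `λ₁ < λ₂ < …` (distinct eigenvalues, numbered from
`1`): it is an eigenvalue, and exactly `k - 1` eigenvalues are smaller. -/
def IsKthEigenvalue {n : ℕ} {h : Rn n → ℝ} (hh : IsWeight h) (k : ℕ) (lam : ℝ) : Prop :=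
  IsEigenvalue hh lam ∧ {μ : ℝ | IsEigenvalue hh μ ∧ μ < lam}.encard + 1 = k

/-- `X₋ = N_{λ₁} ⊕ ⋯ ⊕ N_{λ_{k-1}}`, where `lam = λ_k`. -/
def Xminus {n : ℕ} {h : Rn n → ℝ} (hh : IsWeight h) (lam : ℝ) : Submodule ℝ (H1 n) :=
  ⨆ μ ∈ {μ : ℝ | IsEigenvalue hh μ ∧ μ < lam}, eigenspace hh μ

/-- `X₀ = N_{λ_k}`, where `lam = λ_k`. -/
def Xzero {n : ℕ} {h : Rn n → ℝ} (hh : IsWeight h) (lam : ℝ) : Submodule ℝ (H1 n) :=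
  eigenspace hh lam

/-- `X₊ = N_{λ_{k+1}} ⊕ N_{λ_{k+2}} ⊕ ⋯` (Hilbert sum in `H¹`), where `lam = λ_k`. -/
def Xplus {n : ℕ} {h : Rn n → ℝ} (hh : IsWeight h) (lam : ℝ) : Submodule ℝ (H1 n) :=
  (⨆ μ ∈ {μ : ℝ | IsEigenvalue hh μ ∧ lam < μ}, eigenspace hh μ).topologicalClosure

/-- The primitive `G(x, s) = ∫₀ˢ g(x, τ) dτ`. -/
def primitive {n : ℕ} (g : Rn n → ℝ → ℝ) (x : Rn n) (s : ℝ) : ℝ := ∫ τ in (0 : ℝ)..s, g x τ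

/-- The growth bound: `|g(x, t)| ≤ Z(x)` for some everywhere positive `Z ∈ L¹ ∩ L^∞`. -/
def GrowthBound {n : ℕ} (g : Rn n → ℝ → ℝ) : Prop :=
  ∃ Z : Rn n → ℝ, MemLp Z 1 (volume : Measure (Rn n)) ∧ MemLp Z ⊤ (volume : Measure (Rn n)) ∧
    (∀ x, 0 < Z x) ∧ ∀ x t, |g x t| ≤ Z x

/-- The energy functional
`Φ(u) = ½ ∫ (|∇u|² + |u|²) - (lam / 2) ∫ u² h - ∫ G(x, u)`. -/
def energy {n : ℕ} (h : Rn n → ℝ) (g : Rn n → ℝ → ℝ) (lam : ℝ) (u : H1 n) : ℝ :=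
  1 / 2 * (∫ x, (‖grad u x‖ ^ 2 + |fn u x| ^ 2)) - lam / 2 * (∫ x, fn u x ^ 2 * h x)
    - (∫ x, primitive g x (fn u x))

/-- `F(u) → l` as `‖u‖ → ∞`, `u ∈ Y`, for a subspace `Y` of `H¹(ℝⁿ)` with the `H¹` norm. -/
def TendstoAtInfty {n : ℕ} (Y : Submodule ℝ (H1 n)) (F : H1 n → ℝ) (l : Filter ℝ) : Prop :=
  Tendsto (fun u : Y => F (u : H1 n)) (comap (fun u : Y => ‖u‖) atTop) l

/-- Condition `(g₂⁻)`: `∫ G(x, v) → -∞` as `‖v‖ → ∞`, `v ∈ N_{λ_k}`. -/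
def CondMinus {n : ℕ} {h : Rn n → ℝ} (hh : IsWeight h) (g : Rn n → ℝ → ℝ) (lam : ℝ) : Prop :=
  TendstoAtInfty (eigenspace hh lam) (fun v => ∫ x, primitive g x (fn v x)) atBot

/-- Condition `(g₂⁺)`: `∫ G(x, v) → +∞` as `‖v‖ → ∞`, `v ∈ N_{λ_k}`. -/
def CondPlus {n : ℕ} {h : Rn n → ℝ} (hh : IsWeight h) (g : Rn n → ℝ → ℝ) (lam : ℝ) : Prop :=
  TendstoAtInfty (eigenspace hh lam) (fun v => ∫ x, primitive g x (fn v x)) atTop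

end Resonance

end

noncomputable section

namespace Resonance

variable {n : ℕ}

/-! Write `Q u = ‖u‖² - lam ∫ u² h` and `J u = ∫ G(x, u)`, so that `Φ = Q / 2 - J`. Since `Z ∈ L²`,
`J` is Lipschitz on H¹ (`exists_abs_integral_primitive_sub_le`), hence grows at most linearly. If
`lam` is isolated among the eigenvalues, then `Q` is positive definite on `X₊` and negative definite
on `X₋`, each with a quadratic bound, and the quadratic part dominates `J` there. Adding `v ∈ X₀`
leaves `Q` unchanged and replaces `J w` by `J v` up to `C‖w‖`; the hypothesis on `J` over `X₀` then
controls the direction in which `Q` vanishes (`tendstoAtInfty_sup_of_quadratic`).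

The analytic core is the isolation of `lam`, i.e. `finite_setOf_isEigenvalue_le`. It follows from
compactness of the form `∫ u² h`, needed only along orthonormal sequences
(`tendsto_weight_integral_of_orthonormal`): ball averages approximate `u` in L² at rate `r‖∇u‖`, and
the averages tend to zero pointwise by Bessel's inequality. -/

/-! ### L² modulus of continuity of H¹ functions under translation. -/

theorem integral_mul_fderiv_eq (u : H1 n) {φ : Rn n → ℝ} (hφ : ContDiff ℝ ∞ φ)
    (hc : HasCompactSupport φ) (v : Rn n) :
    ∫ x, fn u x * fderiv ℝ φ x v = - ∫ x, inner ℝ v (grad u x) * φ x := by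
  have hv : v = ∑ i, v i • EuclideanSpace.single i (1 : ℝ) := by
    ext j
    simp [Finset.sum_apply, Pi.single_apply]
  have h1 : ∀ x, fn u x * fderiv ℝ φ x v
      = ∑ i, v i * (fn u x * fderiv ℝ φ x (EuclideanSpace.single i 1)) := by
    intro x
    conv_lhs => rw [hv]
    rw [map_sum, Finset.mul_sum]
    refine Finset.sum_congr rfl fun i _ => ?_
    rw [map_smul, smul_eq_mul]
    ring
  have h2 : ∀ x, inner ℝ v (grad u x) * φ x = ∑ i, v i * (grad u x i * φ x) := by
    intro x
    rw [PiLp.inner_apply, Finset.sum_mul]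
    refine Finset.sum_congr rfl fun i _ => ?_
    simp
    ring
  simp_rw [h1, h2]
  rw [integral_finsetSum _ fun i _ => (integrable_mul_fderiv (fn u) hφ hc _).const_mul _,
    integral_finsetSum _ fun i _ => (integrable_coord_mul (grad u) hφ hc i).const_mul _,
    ← Finset.sum_neg_distrib]
  refine Finset.sum_congr rfl fun i _ => ?_
  rw [integral_const_mul, integral_const_mul, ← mul_neg]
  exact congrArg _ (u.2 φ hφ hc i)

theorem abs_integral_inner_mul_le (w : Lp (Rn n) 2 (volume : Measure (Rn n))) {η : Rn n → ℝ}
    (hη : MemLp η 2 (volume : Measure (Rn n))) (v : Rn n) :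
    |∫ x, inner ℝ v (w x) * η x| ≤ ‖w‖ * (eLpNorm η 2 volume).toReal * ‖v‖ := by
  have h1 : ∫ x, inner ℝ v (w x) * η x
      = inner ℝ (hη.toLp η) ((innerSL ℝ v).compLp w) := by
    rw [L2.inner_def]
    apply integral_congr_ae
    filter_upwards [hη.coeFn_toLp, (innerSL ℝ v).coeFn_compLp w] with x hx hx'
    rw [hx, hx']
    simp
  rw [h1]
  calc _ ≤ ‖hη.toLp η‖ * ‖(innerSL ℝ v).compLp w‖ := abs_real_inner_le_norm _ _
    _ ≤ ‖hη.toLp η‖ * (‖v‖ * ‖w‖) := by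
      gcongr
      simpa using (innerSL ℝ v).norm_compLp_le w
    _ = _ := by rw [Lp.norm_toLp]; ring

/-- The two integrals are values of the differentiable convolution `u ⋆ φ` at `y` and `0`. Its
derivative falls on `φ`, moves to `u` as the weak gradient, and is bounded by Cauchy–Schwarz; the
mean value inequality concludes. -/
theorem abs_integral_translate_sub_le (u : H1 n) {φ : Rn n → ℝ} (hφ : ContDiff ℝ ∞ φ)
    (hc : HasCompactSupport φ) (y : Rn n) :
    |(∫ x, fn u x * φ (y - x)) - ∫ x, fn u x * φ (-x)|
      ≤ ‖grad u‖ * (eLpNorm φ 2 volume).toReal * ‖y‖ := by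
  set C : Rn n → ℝ := convolution (fn u) φ (ContinuousLinearMap.mul ℝ ℝ) volume with hC
  have hloc : LocallyIntegrable (fn u) volume :=
    (Lp.memLp (fn u)).locallyIntegrable (by norm_num)
  have hd : ∀ z, HasFDerivAt C _ z := fun z =>
    hc.hasFDerivAt_convolution_right (ContinuousLinearMap.mul ℝ ℝ) hloc (hφ.of_le (by simp)) z
  have hbound : ∀ z, ‖fderiv ℝ C z‖ ≤ ‖grad u‖ * (eLpNorm φ 2 volume).toReal := by
    intro z
    refine ContinuousLinearMap.opNorm_le_bound _ (by positivity) fun v => ?_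
    rw [(hd z).fderiv]
    have hη : ContDiff ℝ ∞ fun x => φ (z - x) := hφ.comp (contDiff_const.sub contDiff_id)
    have hηc : HasCompactSupport fun x => φ (z - x) :=
      hc.comp_homeomorph (Homeomorph.subLeft z)
    have hder : ∀ x, fderiv ℝ (fun x => φ (z - x)) x v = - fderiv ℝ φ (z - x) v := by
      intro x
      have h1 : HasFDerivAt (fun x => φ (z - x)) _ x :=
        ((hφ.differentiable (by simp)).differentiableAt (x := z - x)).hasFDerivAt.comp x
          ((hasFDerivAt_const z x).sub (hasFDerivAt_id x))
      rw [h1.fderiv]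
      simp
    have hci : ConvolutionExistsAt (fn u) (fderiv ℝ φ) z
        ((ContinuousLinearMap.mul ℝ ℝ).precompR (Rn n)) volume :=
      (hc.fderiv ℝ).convolutionExists_right _ hloc (hφ.continuous_fderiv (by simp)) z
    have h2 : (convolution (fn u) (fderiv ℝ φ)
        ((ContinuousLinearMap.mul ℝ ℝ).precompR (Rn n)) volume z) v
        = ∫ x, fn u x * fderiv ℝ φ (z - x) v := by
      rw [convolution, ContinuousLinearMap.integral_apply hci]
      rfl
    have h3 := integral_mul_fderiv_eq u hη hηc v
    simp_rw [hder, mul_neg, integral_neg, neg_inj] at h3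
    rw [h2, h3, Real.norm_eq_abs]
    refine (abs_integral_inner_mul_le (grad u)
      (hη.continuous.memLp_of_hasCompactSupport hηc) v).trans_eq ?_
    congr 3
    exact eLpNorm_comp_measurePreserving hφ.continuous.aestronglyMeasurable
      (Measure.measurePreserving_sub_left volume z)
  have := (convex_univ (𝕜 := ℝ) (E := Rn n)).norm_image_sub_le_of_norm_fderiv_le (f := C)
    (fun z _ => (hd z).differentiableAt) (fun z _ => hbound z) (Set.mem_univ 0) (Set.mem_univ y)
  simpa [hC, convolution] using this

/-- The translate `x ↦ u (x - y)` of an `L²` function. -/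
def translate (y : Rn n) (u : Lp ℝ 2 (volume : Measure (Rn n))) :
    Lp ℝ 2 (volume : Measure (Rn n)) :=
  Lp.compMeasurePreserving (fun x => x - y) (measurePreserving_sub_right volume y) u

theorem coeFn_translate (y : Rn n) (u : Lp ℝ 2 (volume : Measure (Rn n))) :
    translate y u =ᵐ[volume] fun x => u (x - y) :=
  Lp.coeFn_compMeasurePreserving u _

/-- By duality: the difference is tested against smooth compactly supported functions, which are
dense in L², and finally against itself. -/
theorem norm_sub_translate_le (u : H1 n) (y : Rn n) :
    ‖fn u - translate y (fn u)‖ ≤ ‖grad u‖ * ‖y‖ := by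
  set D := fn u - translate y (fn u) with hD
  have key : ∀ f : Lp ℝ 2 (volume : Measure (Rn n)),
      |inner ℝ D f| ≤ ‖grad u‖ * ‖y‖ * ‖f‖ := by
    refine fun f => (Lp.dense_hasCompactSupport_contDiff (F := ℝ) (μ := (volume : Measure (Rn n)))
      (p := 2) (by simp)).induction (P := fun f => |inner ℝ D f| ≤ ‖grad u‖ * ‖y‖ * ‖f‖) ?_ ?_ f
    · rintro f ⟨φ, hfφ, hc, hφ⟩
      have h2 : MemLp φ 2 (volume : Measure (Rn n)) := hφ.continuous.memLp_of_hasCompactSupport hc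
      have hψ : ContDiff ℝ ∞ fun x => φ (-x) := hφ.comp contDiff_neg
      have hψc : HasCompactSupport fun x => φ (-x) := hc.comp_homeomorph (Homeomorph.neg _)
      -- The reflected test function and the shift `-y` turn the convolution integrals into `∫ u(x -
      -- y) φ(x)` and `∫ u φ`.
      have h3 := abs_integral_translate_sub_le u hψ hψc (-y)
      have hn : eLpNorm (fun x => φ (-x)) 2 volume = ENNReal.ofReal ‖f‖ := by
        rw [Lp.norm_def, ENNReal.ofReal_toReal (Lp.eLpNorm_ne_top f), eLpNorm_congr_ae hfφ]
        exact eLpNorm_comp_measurePreserving hφ.continuous.aestronglyMeasurable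
          (Measure.measurePreserving_neg volume)
      rw [hn, ENNReal.toReal_ofReal (norm_nonneg _), norm_neg] at h3
      have i1 : Integrable (fun x => fn u x * φ x) := (Lp.memLp (fn u)).integrable_mul h2
      have i2 : Integrable (fun x => fn u (x - y) * φ x) :=
        ((Lp.memLp (fn u)).comp_measurePreserving
          (measurePreserving_sub_right volume y)).integrable_mul h2
      have h4 : inner ℝ D f = (∫ x, fn u x * φ x) - ∫ x, fn u (x - y) * φ x := by
        rw [L2.inner_def, ← integral_sub i1 i2]
        apply integral_congr_ae
        filter_upwards [hfφ, Lp.coeFn_sub (fn u) (translate y (fn u)), coeFn_translate y (fn u)]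
          with x h1 h2 h3
        rw [hD, h1, h2, Pi.sub_apply, h3]
        simp
        ring
      have h5 : ∫ x, fn u (x - y) * φ x = ∫ x, fn u x * φ (-(-y - x)) := by
        rw [← integral_sub_right_eq_self (fun x => fn u x * φ (-(-y - x))) y]
        congr 1 with x
        congr 2
        abel
      rw [h4, h5, abs_sub_comm]
      simp only [neg_neg] at h3
      linarith
    · exact isClosed_le (by fun_prop) (by fun_prop)
  have := key D
  rw [real_inner_self_eq_norm_sq, abs_of_nonneg (by positivity)] at this
  by_contra! hlt
  have hpos : 0 < ‖D‖ := lt_of_le_of_lt (by positivity) hlt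
  nlinarith

/-! ### Approximation by ball averages. -/

/-- The uniform probability measure on the ball of radius `r` centred at the origin. -/
abbrev ballMeasure (n : ℕ) (r : ℝ) : Measure (Rn n) :=
  ProbabilityTheory.cond volume (Metric.ball 0 r)

theorem isProbabilityMeasure_ballMeasure {r : ℝ} (hr : 0 < r) :
    IsProbabilityMeasure (ballMeasure n r) :=
  ProbabilityTheory.cond_isProbabilityMeasure_of_finite
    (Metric.measure_ball_pos volume 0 hr).ne' measure_ball_lt_top.ne

/-- The average of `u` over the ball of radius `r` centred at `x`. -/
def ballAverage (r : ℝ) (u : Rn n → ℝ) (x : Rn n) : ℝ := ∫ y, u (x - y) ∂(ballMeasure n r)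

theorem stronglyMeasurable_ballAverage {r : ℝ} (hr : 0 < r)
    (u : Lp ℝ 2 (volume : Measure (Rn n))) : StronglyMeasurable (ballAverage r u) := by
  have := isProbabilityMeasure_ballMeasure (n := n) hr
  have h : StronglyMeasurable fun p : Rn n × Rn n => u (p.1 - p.2) :=
    (Lp.stronglyMeasurable u).comp_measurable (measurable_fst.sub measurable_snd)
  exact h.integral_prod_right

theorem memLp_sub_ballMeasure {r : ℝ} (hr : 0 < r) (u : Lp ℝ 2 (volume : Measure (Rn n)))
    (x : Rn n) : MemLp (fun y => u (x - y)) 2 (ballMeasure n r) := by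
  have h := (Lp.memLp u).comp_measurePreserving (Measure.measurePreserving_sub_left volume x)
  refine MemLp.smul_measure (h.restrict _) ?_
  exact ENNReal.inv_ne_top.2 (Metric.measure_ball_pos volume 0 hr).ne'

theorem sq_enorm_integral_le {α : Type*} [MeasurableSpace α] {ν : Measure α}
    [IsProbabilityMeasure ν] {f : α → ℝ} (hf : AEStronglyMeasurable f ν) :
    ‖∫ y, f y ∂ν‖ₑ ^ (2 : ℝ) ≤ ∫⁻ y, ‖f y‖ₑ ^ (2 : ℝ) ∂ν := by
  have h1 : ‖∫ y, f y ∂ν‖ₑ ≤ eLpNorm f 2 ν :=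
    calc _ ≤ eLpNorm f 1 ν := by
          rw [eLpNorm_one_eq_lintegral_enorm]; exact enorm_integral_le_lintegral_enorm _
      _ ≤ _ := eLpNorm_le_eLpNorm_of_exponent_le (by norm_num) hf
  calc _ ≤ eLpNorm f 2 ν ^ (2 : ℝ) := by gcongr
    _ = _ := eLpNorm_nnreal_pow_eq_lintegral (p := 2) (by norm_num)

/-- The left side averages `u(x) - u(x - y)` over `‖y‖ < r`; Jensen, Tonelli and the translation
estimate for each `y` give the bound. -/
theorem eLpNorm_sub_ballAverage_le {r : ℝ} (hr : 0 < r) (u : H1 n) :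
    eLpNorm (fun x => fn u x - ballAverage r (fn u) x) 2 volume
      ≤ ENNReal.ofReal (‖grad u‖ * r) := by
  have := isProbabilityMeasure_ballMeasure (n := n) hr
  have hsm := Lp.stronglyMeasurable (fn u)
  have hpt : ∀ x, ‖fn u x - ballAverage r (fn u) x‖ₑ ^ (2 : ℝ)
      ≤ ∫⁻ y, ‖fn u x - fn u (x - y)‖ₑ ^ (2 : ℝ) ∂(ballMeasure n r) := by
    intro x
    have hm := memLp_sub_ballMeasure hr (fn u) x
    have h1 : fn u x - ballAverage r (fn u) x
        = ∫ y, (fn u x - fn u (x - y)) ∂(ballMeasure n r) := by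
      rw [integral_sub (integrable_const _) (hm.integrable (by norm_num))]
      simp [ballAverage]
    rw [h1]
    exact sq_enorm_integral_le (aestronglyMeasurable_const.sub hm.1)
  have hy : ∀ y ∈ Metric.ball (0 : Rn n) r,
      ∫⁻ x, ‖fn u x - fn u (x - y)‖ₑ ^ (2 : ℝ) ≤ ENNReal.ofReal (‖grad u‖ * r) ^ (2 : ℝ) := by
    intro y hy
    have h1 : ∫⁻ x, ‖fn u x - fn u (x - y)‖ₑ ^ (2 : ℝ)
        = eLpNorm (fn u - translate y (fn u) : Lp ℝ 2 (volume : Measure (Rn n))) 2 volume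
          ^ (2 : ℝ) := by
      refine Eq.trans ?_ (eLpNorm_nnreal_pow_eq_lintegral (p := 2) (by norm_num)).symm
      apply lintegral_congr_ae
      filter_upwards [Lp.coeFn_sub (fn u) (translate y (fn u)), coeFn_translate y (fn u)]
        with x h1 h2
      rw [h1, Pi.sub_apply, h2]
      rfl
    rw [h1]
    gcongr
    rw [← ENNReal.ofReal_toReal (Lp.eLpNorm_ne_top _), ← Lp.norm_def]
    refine ENNReal.ofReal_le_ofReal ((norm_sub_translate_le u y).trans ?_)
    gcongr
    exact (mem_ball_zero_iff.1 hy).le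
  rw [← ENNReal.rpow_le_rpow_iff (z := 2) (by norm_num)]
  calc eLpNorm (fun x => fn u x - ballAverage r (fn u) x) 2 volume ^ (2 : ℝ)
      = ∫⁻ x, ‖fn u x - ballAverage r (fn u) x‖ₑ ^ (2 : ℝ) :=
        eLpNorm_nnreal_pow_eq_lintegral (p := 2) (by norm_num)
    _ ≤ ∫⁻ x, ∫⁻ y, ‖fn u x - fn u (x - y)‖ₑ ^ (2 : ℝ) ∂(ballMeasure n r) :=
        lintegral_mono hpt
    _ = ∫⁻ y, (∫⁻ x, ‖fn u x - fn u (x - y)‖ₑ ^ (2 : ℝ)) ∂(ballMeasure n r) := by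
        apply lintegral_lintegral_swap
        have h : StronglyMeasurable fun p : Rn n × Rn n => fn u p.1 - fn u (p.1 - p.2) :=
          (hsm.comp_measurable measurable_fst).sub
            (hsm.comp_measurable (measurable_fst.sub measurable_snd))
        exact (h.enorm.pow_const _).aemeasurable
    _ ≤ ∫⁻ _, ENNReal.ofReal (‖grad u‖ * r) ^ (2 : ℝ) ∂(ballMeasure n r) := by
        apply lintegral_mono_ae
        filter_upwards [ProbabilityTheory.ae_cond_mem Metric.isOpen_ball.measurableSet] with y h
        exact hy y h
    _ = _ := by simp

/-- The `L²` function whose inner product with `u` is the average of `u` over a ball. -/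
def ballKernel (r : ℝ) (x : Rn n) : Lp ℝ 2 (volume : Measure (Rn n)) :=
  (volume.real (Metric.ball (0 : Rn n) r))⁻¹ • indicatorConstLp 2 (s := Metric.ball x r)
    Metric.isOpen_ball.measurableSet measure_ball_lt_top.ne (1 : ℝ)

theorem inner_ballKernel (r : ℝ) (x : Rn n) (u : Lp ℝ 2 (volume : Measure (Rn n))) :
    inner ℝ (ballKernel r x) u = ballAverage r u x := by
  have h : ∫ y in Metric.ball (0 : Rn n) r, u (x - y) = ∫ y in Metric.ball x r, u y := by
    rw [← integral_indicator Metric.isOpen_ball.measurableSet,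
      ← integral_indicator Metric.isOpen_ball.measurableSet,
      ← integral_sub_left_eq_self _ volume x]
    congr 1 with y
    simp [Set.indicator, Metric.mem_ball, dist_eq_norm, norm_sub_rev]
  rw [ballKernel, real_inner_smul_left, L2.inner_indicatorConstLp_one, ← h, ballAverage,
    ballMeasure, ProbabilityTheory.cond.eq_1, integral_smul_measure]
  simp [Measure.real]

theorem norm_ballKernel (r : ℝ) (x : Rn n) :
    ‖ballKernel r x‖ = ‖ballKernel (n := n) r 0‖ := by
  rw [ballKernel, ballKernel, norm_smul, norm_smul,
    norm_indicatorConstLp (by norm_num) (by norm_num),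
    norm_indicatorConstLp (by norm_num) (by norm_num), Measure.real, Measure.real,
    Measure.addHaar_ball_center volume x r]

theorem norm_fn_le (u : H1 n) : ‖fn u‖ ≤ ‖u‖ := WithLp.norm_fst_le _ (u : L2Pair n)

theorem norm_grad_le (u : H1 n) : ‖grad u‖ ≤ ‖u‖ := WithLp.norm_snd_le _ (u : L2Pair n)

theorem abs_ballAverage_le (r : ℝ) (u : H1 n) (x : Rn n) :
    |ballAverage r (fn u) x| ≤ ‖ballKernel (n := n) r 0‖ * ‖u‖ := by
  rw [← inner_ballKernel, ← norm_ballKernel r x]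
  refine (abs_real_inner_le_norm _ _).trans ?_
  gcongr
  exact norm_fn_le u

/-- For fixed `x` the average is the inner product with the fixed vector `(ballKernel r x, 0)`, so
Bessel's inequality makes its squares summable in `j`. -/
theorem tendsto_ballAverage_of_orthonormal (r : ℝ) {u : ℕ → H1 n} (hu : Orthonormal ℝ u)
    (x : Rn n) : Tendsto (fun j => ballAverage r (fn (u j)) x) atTop (𝓝 0) := by
  have hu' : Orthonormal ℝ fun j => (u j : L2Pair n) :=
    hu.comp_linearIsometry (H1 n).subtypeₗᵢ
  have h := (hu'.inner_products_summable (WithLp.toLp 2 (ballKernel r x, 0))).tendsto_atTop_zero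
  have h2 : ∀ j, inner ℝ (u j : L2Pair n) (WithLp.toLp 2 (ballKernel r x, 0))
      = ballAverage r (fn (u j)) x := by
    intro j
    rw [real_inner_comm, WithLp.prod_inner_apply, ← inner_ballKernel]
    simp [fn]
  simp_rw [h2] at h
  rw [tendsto_zero_iff_norm_tendsto_zero]
  simpa [Real.sqrt_sq_eq_abs] using h.sqrt

/-! ### Compactness of the weighted form along orthonormal sequences. -/

theorem IsWeight.exists_bound {h : Rn n → ℝ} (hh : IsWeight h) :
    ∃ H, 0 ≤ H ∧ ∀ᵐ x, h x ≤ H := by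
  refine ⟨(eLpNormEssSup h volume).toReal, by positivity, ?_⟩
  have hfin : eLpNormEssSup h volume ≠ ⊤ := by
    simpa [eLpNorm_exponent_top] using hh.memLp_top.2.ne
  filter_upwards [ae_le_eLpNormEssSup (f := h) (μ := volume)] with x hx
  have := ENNReal.toReal_mono hfin hx
  simp only [toReal_enorm] at this
  exact (le_abs_self _).trans this

/-- Dominated convergence: the averages are bounded uniformly in `x` and `j`, and `h ∈ L¹` supplies
the majorant. -/
theorem tendsto_integral_mul_ballAverage_sq {h : Rn n → ℝ} (hh : IsWeight h) {r : ℝ} (hr : 0 < r)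
    {u : ℕ → H1 n} (hu : Orthonormal ℝ u) :
    Tendsto (fun j => ∫ x, h x * ballAverage r (fn (u j)) x ^ 2) atTop (𝓝 0) := by
  have h1 : Integrable h := memLp_one_iff_integrable.1 hh.memLp_one
  have h0 : (0 : ℝ) = ∫ _ : Rn n, (0 : ℝ) := by simp
  rw [h0]
  refine tendsto_integral_of_dominated_convergence
    (fun x => h x * ‖ballKernel (n := n) r 0‖ ^ 2) (fun j => ?_) (h1.mul_const _)
    (fun j => ?_) ?_
  · exact h1.1.mul ((stronglyMeasurable_ballAverage hr _).pow 2).aestronglyMeasurable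
  · refine Eventually.of_forall fun x => ?_
    have := abs_ballAverage_le r (u j) x
    rw [hu.1 j, mul_one] at this
    rw [norm_mul, norm_pow, Real.norm_eq_abs, Real.norm_eq_abs, abs_of_nonneg (hh.nonneg x)]
    have := hh.nonneg x
    gcongr
  · refine Eventually.of_forall fun x => ?_
    simpa using ((tendsto_ballAverage_of_orthonormal r hu x).pow 2).const_mul (h x)

/-- Split `u` into its ball average and the remainder. The remainder costs at most `2 H r²`
uniformly in `j`, so `r` is fixed first; then the averaged part tends to zero. -/
theorem tendsto_weight_integral_of_orthonormal {h : Rn n → ℝ} (hh : IsWeight h)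
    {u : ℕ → H1 n} (hu : Orthonormal ℝ u) :
    Tendsto (fun j => ∫ x, fn (u j) x * fn (u j) x * h x) atTop (𝓝 0) := by
  obtain ⟨H, hH0, hH⟩ := hh.exists_bound
  have h1 : Integrable h := memLp_one_iff_integrable.1 hh.memLp_one
  have key : ∀ r, 0 < r → ∀ j, ∫ x, fn (u j) x * fn (u j) x * h x
      ≤ 2 * H * r ^ 2 + 2 * ∫ x, h x * ballAverage r (fn (u j)) x ^ 2 := by
    intro r hr j
    set a := ballAverage r (fn (u j)) with ha
    have ham := stronglyMeasurable_ballAverage hr (fn (u j))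
    have hle := eLpNorm_sub_ballAverage_le hr (u j)
    have hD : MemLp (fun x => fn (u j) x - a x) 2 volume :=
      ⟨((Lp.stronglyMeasurable _).sub ham).aestronglyMeasurable,
        hle.trans_lt ENNReal.ofReal_lt_top⟩
    have hDi : ∫ x, (fn (u j) x - a x) ^ 2 ≤ r ^ 2 := by
      have e : ∫ x, (fn (u j) x - a x) ^ 2 = ‖hD.toLp _‖ ^ 2 := by
        rw [← real_inner_self_eq_norm_sq, L2.inner_def]
        apply integral_congr_ae
        filter_upwards [hD.coeFn_toLp] with x hx
        rw [hx]
        simp [sq]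
      rw [e, Lp.norm_toLp]
      have h2 : (eLpNorm (fun x => fn (u j) x - a x) 2 volume).toReal ≤ r := by
        refine (ENNReal.toReal_mono ENNReal.ofReal_ne_top hle).trans ?_
        rw [ENNReal.toReal_ofReal (by positivity)]
        have := norm_grad_le (u j)
        rw [hu.1 j] at this
        nlinarith
      gcongr
    have hai : Integrable fun x => h x * a x ^ 2 := by
      refine h1.mul_bdd (c := (‖ballKernel (n := n) r 0‖ * ‖u j‖) ^ 2)
        (ham.pow 2).aestronglyMeasurable (Eventually.of_forall fun x => ?_)
      rw [norm_pow, Real.norm_eq_abs]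
      gcongr
      exact abs_ballAverage_le r (u j) x
    calc _ ≤ ∫ x, (2 * H * (fn (u j) x - a x) ^ 2 + 2 * (h x * a x ^ 2)) := by
          refine integral_mono_ae (hh.integrable _ _)
            ((hD.integrable_sq.const_mul _).add (hai.const_mul _)) ?_
          filter_upwards [hH] with x hx
          have := hh.nonneg x
          have e1 : (fn (u j) x) ^ 2 ≤ 2 * (fn (u j) x - a x) ^ 2 + 2 * a x ^ 2 := by
            nlinarith [sq_nonneg (fn (u j) x - 2 * a x)]
          have e2 : h x * (fn (u j) x - a x) ^ 2 ≤ H * (fn (u j) x - a x) ^ 2 := by gcongr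
          have e3 := mul_le_mul_of_nonneg_left e1 this
          nlinarith
      _ = 2 * H * (∫ x, (fn (u j) x - a x) ^ 2) + 2 * ∫ x, h x * a x ^ 2 := by
          rw [integral_add (hD.integrable_sq.const_mul _) (hai.const_mul _),
            integral_const_mul, integral_const_mul]
      _ ≤ _ := by gcongr
  have hnn : ∀ j, 0 ≤ ∫ x, fn (u j) x * fn (u j) x * h x := fun j =>
    integral_nonneg fun x => mul_nonneg (mul_self_nonneg _) (hh.nonneg x)
  rw [Metric.tendsto_atTop]
  intro ε hε
  obtain ⟨r, hr, hrε⟩ : ∃ r : ℝ, 0 < r ∧ 2 * H * r ^ 2 < ε / 2 := by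
    have hc : Tendsto (fun r : ℝ => 2 * H * r ^ 2) (𝓝[>] 0) (𝓝 0) := by
      have : Continuous fun r : ℝ => 2 * H * r ^ 2 := by fun_prop
      simpa using (this.tendsto 0).mono_left nhdsWithin_le_nhds
    obtain ⟨r, hr⟩ := ((hc.eventually_lt_const (half_pos hε)).and self_mem_nhdsWithin).exists
    exact ⟨r, hr.2, hr.1⟩
  obtain ⟨N, hN⟩ := Metric.tendsto_atTop.1 (tendsto_integral_mul_ballAverage_sq hh hr hu)
    (ε / 4) (by positivity)
  refine ⟨N, fun j hj => ?_⟩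
  have h2 := hN j hj
  rw [Real.dist_eq, sub_zero] at h2 ⊢
  rw [abs_of_nonneg (hnn j)]
  have := key r hr j
  have := le_abs_self (∫ x, h x * ballAverage r (fn (u j)) x ^ 2)
  linarith

/-! ### The weighted bilinear form, eigenspaces and spectral gaps. -/

section

theorem integral_abs_mul_abs_le (f g : Lp ℝ 2 (volume : Measure (Rn n))) :
    ∫ x, |f x| * |g x| ≤ ‖f‖ * ‖g‖ := by
  have h : ∫ x, |f x| * |g x| = inner ℝ |f| |g| := by
    rw [L2.inner_def]
    apply integral_congr_ae
    filter_upwards [Lp.coeFn_abs f, Lp.coeFn_abs g] with x h1 h2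
    rw [h1, h2]
    simp [mul_comm]
  rw [h, ← norm_abs_eq_norm f, ← norm_abs_eq_norm g]
  exact real_inner_le_norm _ _

theorem IsWeight.exists_abs_integral_le {h : Rn n → ℝ} (hh : IsWeight h) :
    ∃ H, ∀ u v : H1 n, ‖∫ x, fn u x * fn v x * h x‖ ≤ H * ‖u‖ * ‖v‖ := by
  obtain ⟨H, hH0, hH⟩ := hh.exists_bound
  refine ⟨H, fun u v => ?_⟩
  have hi : Integrable fun x => |fn u x| * |fn v x| :=
    (Lp.memLp (fn u)).norm.integrable_mul (Lp.memLp (fn v)).norm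
  calc _ ≤ ∫ x, H * (|fn u x| * |fn v x|) := by
        refine norm_integral_le_of_norm_le (hi.const_mul H) ?_
        filter_upwards [hH] with x hx
        rw [norm_mul, norm_mul, mul_comm H, Real.norm_eq_abs (h x), abs_of_nonneg (hh.nonneg x)]
        simp only [Real.norm_eq_abs]
        gcongr
    _ ≤ H * (‖fn u‖ * ‖fn v‖) := by
        rw [integral_const_mul]
        gcongr
        exact integral_abs_mul_abs_le _ _
    _ ≤ H * (‖u‖ * ‖v‖) := by
        gcongr
        exacts [norm_fn_le u, norm_fn_le v]
    _ = _ := by ring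

theorem integral_weight_comm (h : Rn n → ℝ) (u v : H1 n) :
    ∫ x, fn u x * fn v x * h x = ∫ x, fn v x * fn u x * h x := by
  simp_rw [mul_comm (fn u _)]

theorem IsWeight.integral_add_left {h : Rn n → ℝ} (hh : IsWeight h) (u v w : H1 n) :
    ∫ x, fn (u + v) x * fn w x * h x
      = (∫ x, fn u x * fn w x * h x) + ∫ x, fn v x * fn w x * h x := by
  rw [← integral_add (hh.integrable _ _) (hh.integrable _ _)]
  apply integral_congr_ae
  filter_upwards [Lp.coeFn_add (fn u) (fn v)] with x hx
  have : fn (u + v) = fn u + fn v := rfl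
  rw [this, hx, Pi.add_apply]
  ring

theorem integral_weight_smul_left (h : Rn n → ℝ) (c : ℝ) (u w : H1 n) :
    ∫ x, fn (c • u) x * fn w x * h x = c * ∫ x, fn u x * fn w x * h x := by
  rw [← integral_const_mul]
  apply integral_congr_ae
  filter_upwards [Lp.coeFn_smul c (fn u)] with x hx
  have : fn (c • u) = c • fn u := rfl
  rw [this, hx, Pi.smul_apply, smul_eq_mul]
  ring

/-- The bilinear form `(u, v) ↦ ∫ u v h` on `H¹`. -/
def weightForm {h : Rn n → ℝ} (hh : IsWeight h) : H1 n →ₗ[ℝ] H1 n →ₗ[ℝ] ℝ :=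
  LinearMap.mk₂ ℝ (fun u v => ∫ x, fn u x * fn v x * h x) hh.integral_add_left
    (integral_weight_smul_left h)
    (fun u v w => by
      rw [integral_weight_comm, hh.integral_add_left, integral_weight_comm h v,
        integral_weight_comm h w])
    (fun c u v => by
      rw [integral_weight_comm, integral_weight_smul_left, integral_weight_comm h v, smul_eq_mul])

variable {h : Rn n → ℝ} (hh : IsWeight h)

theorem weightForm_apply (u v : H1 n) :
    weightForm hh u v = ∫ x, fn u x * fn v x * h x := rfl

theorem weightForm_comm (u v : H1 n) : weightForm hh u v = weightForm hh v u :=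
  integral_weight_comm h u v

theorem weightForm_self_nonneg (u : H1 n) : 0 ≤ weightForm hh u u :=
  integral_nonneg fun x => mul_nonneg (mul_self_nonneg _) (hh.nonneg x)

theorem continuous_weightForm_self : Continuous fun u : H1 n => weightForm hh u u := by
  obtain ⟨H, hH⟩ := hh.exists_abs_integral_le
  have h1 : Continuous fun u : H1 n => (weightForm hh).mkContinuous₂ H hH u u :=
    ((weightForm hh).mkContinuous₂ H hH).continuous.clm_apply continuous_id
  exact h1

theorem inner_eq_of_mem_eigenspace {μ : ℝ} {u : H1 n} (hu : u ∈ eigenspace hh μ) (φ : H1 n) :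
    inner ℝ u φ = μ * weightForm hh u φ := by
  rw [← inner_eq]
  exact hu φ

theorem inner_eq_zero_of_mem_eigenspace {μ ν : ℝ} (hμν : μ ≠ ν) {u v : H1 n}
    (hu : u ∈ eigenspace hh μ) (hv : v ∈ eigenspace hh ν) : inner ℝ u v = 0 := by
  have h1 := inner_eq_of_mem_eigenspace hh hu v
  have h2 := inner_eq_of_mem_eigenspace hh hv u
  rw [real_inner_comm, weightForm_comm hh v u] at h2
  have h3 : (μ - ν) * weightForm hh u v = 0 := by linarith
  rcases mul_eq_zero.1 h3 with h4 | h4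
  · exact absurd (sub_eq_zero.1 h4) hμν
  · rw [h1, h4, mul_zero]

theorem IsEigenvalue.pos {μ : ℝ} (hμ : IsEigenvalue hh μ) : 0 < μ := by
  obtain ⟨u, hu, hne⟩ := (Submodule.ne_bot_iff _).1 hμ
  have h1 := inner_eq_of_mem_eigenspace hh hu u
  have h2 : 0 < inner ℝ u u := real_inner_self_pos.2 hne
  exact pos_of_mul_pos_left (h1 ▸ h2) (weightForm_self_nonneg hh u)

/-- Otherwise normalized eigenvectors of distinct eigenvalues would form an orthonormal sequence
with `1 ≤ M ∫ u² h`, while these integrals tend to zero. -/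
theorem finite_setOf_isEigenvalue_le (M : ℝ) : {μ | IsEigenvalue hh μ ∧ μ ≤ M}.Finite := by
  by_contra hinf
  let e := Set.Infinite.natEmbedding _ hinf
  have hex : ∀ j, ∃ u ∈ eigenspace hh (e j : ℝ), ‖u‖ = 1 := by
    intro j
    obtain ⟨u, hu, hne⟩ := (Submodule.ne_bot_iff _).1 (e j).2.1
    exact ⟨‖u‖⁻¹ • u, Submodule.smul_mem _ _ hu, norm_smul_inv_norm (𝕜 := ℝ) hne⟩
  choose u hu hnorm using hex
  have hort : Orthonormal ℝ u := by
    refine ⟨hnorm, fun i j hij => ?_⟩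
    exact inner_eq_zero_of_mem_eigenspace hh
      (fun h => hij (e.injective (Subtype.ext h))) (hu i) (hu j)
  have hlim := tendsto_weight_integral_of_orthonormal hh hort
  have hM : ∀ j, 1 ≤ M * ∫ x, fn (u j) x * fn (u j) x * h x := by
    intro j
    have h1 := inner_eq_of_mem_eigenspace hh (hu j) (u j)
    rw [real_inner_self_eq_norm_sq, hnorm j, one_pow] at h1
    have h2 := mul_le_mul_of_nonneg_right (e j).2.2 (weightForm_self_nonneg hh (u j))
    rw [← h1] at h2
    exact h2
  have := ge_of_tendsto' (hlim.const_mul M) hM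
  rw [mul_zero] at this
  linarith

/-- A vector in the span of eigenspaces is a finite sum whose terms satisfy
`⟪f μ, u⟫ = μ * ∫ (f μ) u h`, with `⟪f μ, u⟫ ≥ 0` by orthogonality. -/
theorem exists_finset_sum_of_mem_iSup {S : Set ℝ} {u : H1 n}
    (hu : u ∈ ⨆ μ ∈ S, eigenspace hh μ) :
    ∃ (s : Finset S) (a : S → ℝ), (∀ μ : S, 0 ≤ (μ : ℝ) * a μ) ∧
      ‖u‖ ^ 2 = ∑ μ ∈ s, (μ : ℝ) * a μ ∧ weightForm hh u u = ∑ μ ∈ s, a μ := by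
  rw [iSup_subtype', Submodule.mem_iSup_iff_exists_finsupp] at hu
  obtain ⟨f, hf, rfl⟩ := hu
  refine ⟨f.support, fun μ => weightForm hh (f μ) (f.sum fun _ x => x), fun μ => ?_, ?_, ?_⟩
  · rw [← inner_eq_of_mem_eigenspace hh (hf μ), Finsupp.sum, inner_sum]
    refine Finset.sum_nonneg fun ν _ => ?_
    by_cases hμν : μ = ν
    · subst hμν
      exact real_inner_self_nonneg
    · exact (inner_eq_zero_of_mem_eigenspace hh (fun h => hμν (Subtype.ext h))
        (hf μ) (hf ν)).ge
  · rw [← real_inner_self_eq_norm_sq]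
    conv_lhs => enter [2]; rw [Finsupp.sum]
    rw [sum_inner]
    exact Finset.sum_congr rfl fun μ _ => inner_eq_of_mem_eigenspace hh (hf μ) _
  · conv_lhs => enter [1]; rw [Finsupp.sum]
    rw [map_sum, LinearMap.sum_apply]

/-- Termwise comparison of `∑ μ a_μ` with `m ∑ a_μ`; positivity of `μ` makes each `a_μ` nonnegative.
-/
theorem norm_sq_le_of_mem_iSup {S : Set ℝ} {m : ℝ} (hS : ∀ μ ∈ S, 0 < μ ∧ μ ≤ m) {u : H1 n}
    (hu : u ∈ ⨆ μ ∈ S, eigenspace hh μ) : ‖u‖ ^ 2 ≤ m * weightForm hh u u := by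
  obtain ⟨s, a, ha, h1, h2⟩ := exists_finset_sum_of_mem_iSup hh hu
  rw [h1, h2, Finset.mul_sum]
  refine Finset.sum_le_sum fun μ _ => ?_
  have := hS μ μ.2
  exact mul_le_mul_of_nonneg_right this.2 (nonneg_of_mul_nonneg_right (ha μ) this.1)

theorem le_norm_sq_of_mem_iSup {S : Set ℝ} {m : ℝ} (hS : ∀ μ ∈ S, 0 < μ ∧ m ≤ μ) {u : H1 n}
    (hu : u ∈ ⨆ μ ∈ S, eigenspace hh μ) : m * weightForm hh u u ≤ ‖u‖ ^ 2 := by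
  obtain ⟨s, a, ha, h1, h2⟩ := exists_finset_sum_of_mem_iSup hh hu
  rw [h1, h2, Finset.mul_sum]
  refine Finset.sum_le_sum fun μ _ => ?_
  have := hS μ μ.2
  exact mul_le_mul_of_nonneg_right this.2 (nonneg_of_mul_nonneg_right (ha μ) this.1)

theorem le_norm_sq_of_mem_topologicalClosure {S : Set ℝ} {m : ℝ} (hS : ∀ μ ∈ S, 0 < μ ∧ m ≤ μ)
    {u : H1 n} (hu : u ∈ (⨆ μ ∈ S, eigenspace hh μ).topologicalClosure) :
    m * weightForm hh u u ≤ ‖u‖ ^ 2 := by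
  have hcl : IsClosed {u : H1 n | m * weightForm hh u u ≤ ‖u‖ ^ 2} :=
    isClosed_le (continuous_const.mul (continuous_weightForm_self hh)) (by fun_prop)
  exact closure_minimal (fun v hv => le_norm_sq_of_mem_iSup hh hS hv) hcl hu

theorem exists_forall_isEigenvalue_le {lam : ℝ} (hlam : 0 < lam) :
    ∃ m, 0 < m ∧ m < lam ∧ ∀ μ, IsEigenvalue hh μ → μ < lam → μ ≤ m := by
  -- Inserting `lam / 2` keeps the maximum positive and covers the case where no eigenvalue lies
  -- below `lam`.
  have hfin : (insert (lam / 2) {μ | IsEigenvalue hh μ ∧ μ < lam}).Finite :=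
    ((finite_setOf_isEigenvalue_le hh lam).subset fun μ hμ => ⟨hμ.1, hμ.2.le⟩).insert _
  obtain ⟨m, hm, hmax⟩ := Set.exists_max_image _ id hfin ⟨_, Set.mem_insert _ _⟩
  refine ⟨m, ?_, ?_, fun μ h1 h2 => hmax μ (Set.mem_insert_of_mem _ ⟨h1, h2⟩)⟩
  · have := hmax _ (Set.mem_insert _ _)
    simp only [id] at this
    linarith
  · rcases hm with rfl | hm
    · linarith
    · exact hm.2

theorem exists_forall_le_isEigenvalue (lam : ℝ) :
    ∃ m, lam < m ∧ ∀ μ, IsEigenvalue hh μ → lam < μ → m ≤ μ := by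
  -- The cutoff at `lam + 1` gives finiteness; inserting it covers the case of no eigenvalue in the
  -- window.
  have hfin : (insert (lam + 1) {μ | IsEigenvalue hh μ ∧ lam < μ ∧ μ ≤ lam + 1}).Finite :=
    ((finite_setOf_isEigenvalue_le hh (lam + 1)).subset fun μ hμ => ⟨hμ.1, hμ.2.2⟩).insert _
  obtain ⟨m, hm, hmin⟩ := Set.exists_min_image _ id hfin ⟨_, Set.mem_insert _ _⟩
  refine ⟨m, ?_, fun μ h1 h2 => ?_⟩
  · rcases hm with rfl | hm
    · linarith
    · exact hm.2.1
  · rcases le_total μ (lam + 1) with h3 | h3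
    · exact hmin μ (Set.mem_insert_of_mem _ ⟨h1, h2, h3⟩)
    · exact (hmin _ (Set.mem_insert _ _)).trans h3

end

/-! ### The nonlinear term and coercivity of the energy. -/

section

theorem continuous_primitive {g : Rn n → ℝ → ℝ} (hg : Continuous (Function.uncurry g)) :
    Continuous fun p : Rn n × ℝ => primitive g p.1 p.2 :=
  intervalIntegral.continuous_parametric_intervalIntegral_of_continuous
    (f := fun p : Rn n × ℝ => g p.1) (a₀ := 0) (s := Prod.snd)
    (hg.comp ((continuous_fst.comp continuous_fst).prodMk continuous_snd)) continuous_snd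

theorem abs_primitive_sub_le {g : Rn n → ℝ → ℝ} (hg : Continuous (Function.uncurry g))
    {Z : Rn n → ℝ} (hZ : ∀ x t, |g x t| ≤ Z x) (x : Rn n) (s t : ℝ) :
    |primitive g x s - primitive g x t| ≤ Z x * |s - t| := by
  have hc : Continuous (g x) := hg.comp (Continuous.prodMk_right x)
  rw [primitive, primitive, intervalIntegral.integral_interval_sub_left
    (hc.intervalIntegrable _ _) (hc.intervalIntegrable _ _)]
  exact intervalIntegral.norm_integral_le_of_norm_le_const (f := g x) fun τ _ => hZ x τ

theorem memLp_two_of_memLp_one_of_memLp_top {Z : Rn n → ℝ}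
    (h1 : MemLp Z 1 (volume : Measure (Rn n))) (h2 : MemLp Z ⊤ (volume : Measure (Rn n))) :
    MemLp Z 2 (volume : Measure (Rn n)) := by
  rw [memLp_two_iff_integrable_sq h1.1]
  simp_rw [sq]
  exact (memLp_one_iff_integrable.1 h1).mul_of_top_left h2

/-- `G(x, ·)` is `Z(x)`-Lipschitz and `Z ∈ L¹ ∩ L^∞ ⊆ L²`, so Cauchy–Schwarz applies with `C =
‖Z‖₂`. -/
theorem exists_abs_integral_primitive_sub_le {g : Rn n → ℝ → ℝ}
    (hg : Continuous (Function.uncurry g)) (hgZ : GrowthBound g) :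
    ∃ C, 0 ≤ C ∧ ∀ u v : H1 n,
      |(∫ x, primitive g x (fn u x)) - ∫ x, primitive g x (fn v x)| ≤ C * ‖u - v‖ := by
  obtain ⟨Z, hZ1, hZt, -, hZ⟩ := hgZ
  have hZ2 := memLp_two_of_memLp_one_of_memLp_top hZ1 hZt
  have hint : ∀ u : H1 n, Integrable fun x => primitive g x (fn u x) := by
    intro u
    refine (hZ2.integrable_mul (Lp.memLp (fn u)).norm).mono' ?_ (Eventually.of_forall fun x => ?_)
    · exact (continuous_primitive hg).comp_aestronglyMeasurable
        (aestronglyMeasurable_id.prodMk (Lp.aestronglyMeasurable _))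
    · simpa [primitive] using abs_primitive_sub_le hg hZ x (fn u x) 0
  refine ⟨‖hZ2.toLp Z‖, norm_nonneg _, fun u v => ?_⟩
  rw [← integral_sub (hint u) (hint v)]
  have hi : Integrable fun x => |hZ2.toLp Z x| * |fn (u - v) x| :=
    (Lp.memLp (hZ2.toLp Z)).norm.integrable_mul (Lp.memLp (fn (u - v))).norm
  calc _ ≤ ∫ x, |hZ2.toLp Z x| * |fn (u - v) x| := by
        rw [← Real.norm_eq_abs]
        refine norm_integral_le_of_norm_le hi ?_
        filter_upwards [hZ2.coeFn_toLp, Lp.coeFn_sub (fn u) (fn v)] with x h1 h2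
        have : fn (u - v) = fn u - fn v := rfl
        rw [this, h1, h2, Pi.sub_apply]
        refine (abs_primitive_sub_le hg hZ x _ _).trans ?_
        gcongr
        exact le_abs_self _
    _ ≤ ‖hZ2.toLp Z‖ * ‖fn (u - v)‖ := integral_abs_mul_abs_le _ _
    _ ≤ _ := by
        gcongr
        exact norm_fn_le _

variable {h : Rn n → ℝ} (hh : IsWeight h)

theorem energy_eq (g : Rn n → ℝ → ℝ) (lam : ℝ) (u : H1 n) :
    energy h g lam u = (‖u‖ ^ 2 - lam * weightForm hh u u) / 2
      - ∫ x, primitive g x (fn u x) := by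
  have h1 : ∫ x, (‖grad u x‖ ^ 2 + |fn u x| ^ 2) = ‖u‖ ^ 2 := by
    rw [← real_inner_self_eq_norm_sq, ← inner_eq]
    simp [sq]
  rw [energy, h1, weightForm_apply]
  simp_rw [sq (fn u _)]
  ring

/-- The eigenspace lies in the radical of this quadratic form: both the `v`-square and the cross
term vanish by the weak equation. -/
theorem norm_sq_sub_weightForm_add {lam : ℝ} {v : H1 n} (hv : v ∈ eigenspace hh lam)
    (w : H1 n) : ‖v + w‖ ^ 2 - lam * weightForm hh (v + w) (v + w)
      = ‖w‖ ^ 2 - lam * weightForm hh w w := by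
  have h1 := inner_eq_of_mem_eigenspace hh hv v
  have h2 := inner_eq_of_mem_eigenspace hh hv w
  rw [real_inner_self_eq_norm_sq] at h1
  have h3 : weightForm hh (v + w) (v + w)
      = weightForm hh v v + 2 * weightForm hh v w + weightForm hh w w := by
    simp only [map_add, LinearMap.add_apply]
    linear_combination weightForm_comm hh w v
  have h4 := norm_add_sq_real v w
  linear_combination h4 - lam * h3 + h1 + 2 * h2

theorem tendstoAtInfty_atTop_iff {Y : Submodule ℝ (H1 n)} {F : H1 n → ℝ} :
    TendstoAtInfty Y F atTop ↔ ∀ A, ∃ R, ∀ u ∈ Y, R ≤ ‖u‖ → A ≤ F u := by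
  rw [TendstoAtInfty, (atTop_basis.comap _).tendsto_iff atTop_basis]
  simp

theorem tendstoAtInfty_atBot_iff {Y : Submodule ℝ (H1 n)} {F : H1 n → ℝ} :
    TendstoAtInfty Y F atBot ↔ TendstoAtInfty Y (fun u => -F u) atTop :=
  tendsto_neg_atTop_iff.symm

theorem exists_forall_le_quadratic {δ : ℝ} (hδ : 0 < δ) (C A : ℝ) :
    ∃ R, ∀ t, R ≤ t → A ≤ δ * t ^ 2 - C * t := by
  have h : Tendsto (fun t : ℝ => t * (δ * t - C)) atTop atTop :=
    tendsto_id.atTop_mul_atTop₀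
      (tendsto_atTop_add_const_right _ (-C) (tendsto_id.const_mul_atTop hδ))
  obtain ⟨R, hR⟩ := eventually_atTop.1 (h.eventually_ge_atTop A)
  exact ⟨R, fun t ht => (hR t ht).trans_eq (by ring)⟩

theorem tendstoAtInfty_of_quadratic {Y : Submodule ℝ (H1 n)} {F : H1 n → ℝ} {δ C : ℝ}
    (hδ : 0 < δ) (hF : ∀ u ∈ Y, δ * ‖u‖ ^ 2 - C * ‖u‖ ≤ F u) : TendstoAtInfty Y F atTop := by
  rw [tendstoAtInfty_atTop_iff]
  intro A
  obtain ⟨R, hR⟩ := exists_forall_le_quadratic hδ C A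
  exact ⟨R, fun u hu h => (hR _ h).trans (hF u hu)⟩

/-- If `‖v + w‖` is large, then `‖v‖` or `‖w‖` is. Each of the two terms, `P v` and the quadratic in
`‖w‖`, is bounded below, so it suffices that either one is large. Only the triangle inequality is
needed, not orthogonality. -/
theorem tendstoAtInfty_sup_of_quadratic {Y₀ Y₁ : Submodule ℝ (H1 n)} {F P : H1 n → ℝ} {δ C : ℝ}
    (hδ : 0 < δ) (hC : 0 ≤ C) (hP : TendstoAtInfty Y₀ P atTop) (hPC : ∀ v, |P v| ≤ C * ‖v‖)
    (hF : ∀ v ∈ Y₀, ∀ w ∈ Y₁, δ * ‖w‖ ^ 2 - C * ‖w‖ + P v ≤ F (v + w)) :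
    TendstoAtInfty (Y₀ ⊔ Y₁) F atTop := by
  rw [tendstoAtInfty_atTop_iff] at hP ⊢
  obtain ⟨R₀, hR₀⟩ := hP 0
  -- Outside the ball of radius `R₀` coercivity gives `P ≥ 0`; inside, linear growth bounds `P`
  -- below.
  have hPbelow : ∀ v ∈ Y₀, -(C * |R₀|) ≤ P v := by
    intro v hv
    rcases le_total R₀ ‖v‖ with hle | hle
    · have := hR₀ v hv hle
      have : 0 ≤ C * |R₀| := by positivity
      linarith
    · have h1 := neg_le_of_abs_le (hPC v)
      have h2 : C * ‖v‖ ≤ C * |R₀| := by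
        gcongr
        exact hle.trans (le_abs_self _)
      linarith
  have hquad : ∀ t : ℝ, -(C ^ 2 / (4 * δ)) ≤ δ * t ^ 2 - C * t := by
    intro t
    have h1 : δ * t ^ 2 - C * t + C ^ 2 / (4 * δ) = (2 * δ * t - C) ^ 2 / (4 * δ) := by
      field_simp
      ring
    have h2 : 0 ≤ (2 * δ * t - C) ^ 2 / (4 * δ) := by positivity
    linarith
  intro A
  obtain ⟨R₁, hR₁⟩ := hP (A + C ^ 2 / (4 * δ))
  obtain ⟨R₂, hR₂⟩ := exists_forall_le_quadratic hδ C (A + C * |R₀|)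
  refine ⟨R₁ + R₂, fun u hu hle => ?_⟩
  obtain ⟨v, hv, w, hw, rfl⟩ := Submodule.mem_sup.1 hu
  have hF' := hF v hv w hw
  have htri := norm_add_le v w
  rcases le_total R₁ ‖v‖ with h1 | h1
  · have := hR₁ v hv h1
    have := hquad ‖w‖
    linarith
  · have := hR₂ ‖w‖ (by linarith)
    have := hPbelow v hv
    linarith

theorem exists_quadratic_le_Xplus {lam : ℝ} (hlam : 0 < lam) :
    ∃ δ, 0 < δ ∧ ∀ w ∈ Xplus hh lam, δ * ‖w‖ ^ 2 ≤ (‖w‖ ^ 2 - lam * weightForm hh w w) / 2 := by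
  obtain ⟨m, hm, hmin⟩ := exists_forall_le_isEigenvalue hh lam
  have hm0 : 0 < m := hlam.trans hm
  -- From `∫ w² h ≤ ‖w‖² / m`, where `m > lam` bounds all larger eigenvalues from below.
  refine ⟨(1 - lam / m) / 2, half_pos (sub_pos.2 ((div_lt_one hm0).2 hm)), fun w hw => ?_⟩
  have h1 := le_norm_sq_of_mem_topologicalClosure hh (m := m)
    (fun μ hμ => ⟨hlam.trans hμ.2, hmin μ hμ.1 hμ.2⟩) hw
  have h2 : lam * weightForm hh w w ≤ lam / m * ‖w‖ ^ 2 := by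
    calc _ = lam / m * (m * weightForm hh w w) := by field_simp
      _ ≤ _ := by gcongr
  linarith

theorem exists_quadratic_le_Xminus {lam : ℝ} (hlam : 0 < lam) :
    ∃ δ, 0 < δ ∧ ∀ w ∈ Xminus hh lam,
      δ * ‖w‖ ^ 2 ≤ -((‖w‖ ^ 2 - lam * weightForm hh w w) / 2) := by
  obtain ⟨m, hm0, hm, hmax⟩ := exists_forall_isEigenvalue_le hh hlam
  refine ⟨(lam / m - 1) / 2, half_pos (sub_pos.2 ((one_lt_div hm0).2 hm)), fun w hw => ?_⟩
  have h1 := norm_sq_le_of_mem_iSup hh (m := m)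
    (fun μ hμ => ⟨hμ.1.pos hh, hmax μ hμ.1 hμ.2⟩) hw
  have h2 : lam / m * ‖w‖ ^ 2 ≤ lam * weightForm hh w w := by
    calc _ ≤ lam / m * (m * weightForm hh w w) := by gcongr
      _ = _ := by field_simp
  linarith

end

end Resonance

end

/-! ### The four limits. -/

open Resonance

theorem proposition4 (n : ℕ) (hn : 3 ≤ n) (h : Resonance.Rn n → ℝ) (hh : Resonance.IsWeight h)
    (g : Resonance.Rn n → ℝ → ℝ) (hg : Continuous (Function.uncurry g))
    (hgZ : Resonance.GrowthBound g)
    (k : ℕ) (lam : ℝ) (hlam : Resonance.IsKthEigenvalue hh k lam) :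
    (Resonance.CondMinus hh g lam →
      Resonance.TendstoAtInfty (Resonance.Xminus hh lam)
          (Resonance.energy h g lam) atBot ∧
        Resonance.TendstoAtInfty (Resonance.Xzero hh lam ⊔ Resonance.Xplus hh lam)
          (Resonance.energy h g lam) atTop) ∧
      (Resonance.CondPlus hh g lam →
        Resonance.TendstoAtInfty (Resonance.Xzero hh lam ⊔ Resonance.Xminus hh lam)
            (Resonance.energy h g lam) atBot ∧
          Resonance.TendstoAtInfty (Resonance.Xplus hh lam)
            (Resonance.energy h g lam) atTop) := by
  have hpos : 0 < lam := hlam.1.pos hh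
  obtain ⟨C, hC, hJ⟩ := exists_abs_integral_primitive_sub_le hg hgZ
  obtain ⟨δ, hδ, hminus⟩ := exists_quadratic_le_Xminus hh hpos
  obtain ⟨η, hη, hplus⟩ := exists_quadratic_le_Xplus hh hpos
  have hJ0 : ∀ u : H1 n, |∫ x, primitive g x (fn u x)| ≤ C * ‖u‖ := by
    intro u
    have h0 : ∫ x, primitive g x (fn (0 : H1 n) x) = 0 := by
      apply integral_eq_zero_of_ae
      filter_upwards [Lp.coeFn_zero ℝ 2 (volume : Measure (Rn n))] with x hx
      have : fn (0 : H1 n) = 0 := rfl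
      rw [this, hx]
      simp [primitive]
    simpa [h0] using hJ u 0
  have hJadd : ∀ v w : H1 n,
      |(∫ x, primitive g x (fn (v + w) x)) - ∫ x, primitive g x (fn v x)| ≤ C * ‖w‖ :=
    fun v w => by simpa using hJ (v + w) v
  refine ⟨fun hc => ⟨?_, ?_⟩, fun hc => ⟨?_, ?_⟩⟩
  · rw [tendstoAtInfty_atBot_iff]
    refine tendstoAtInfty_of_quadratic (C := C) hδ fun u hu => ?_
    have h1 := hminus u hu
    have h2 := abs_le.1 (hJ0 u)
    rw [energy_eq hh]
    linarith
  -- Here `P = -J`, which tends to `+∞` on `X₀` by `(g₂⁻)`.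
  · refine tendstoAtInfty_sup_of_quadratic (C := C) hη hC (tendstoAtInfty_atBot_iff.1 hc)
      (fun v => by rw [abs_neg]; exact hJ0 v) fun v hv w hw => ?_
    have h1 := hplus w hw
    have h2 := abs_le.1 (hJadd v w)
    rw [energy_eq hh, norm_sq_sub_weightForm_add hh hv]
    linarith
  · rw [tendstoAtInfty_atBot_iff]
    -- For `-Φ` the signs reverse: `P = J`, and the quadratic gain comes from `X₋`.
    refine tendstoAtInfty_sup_of_quadratic (C := C) hδ hC hc hJ0 fun v hv w hw => ?_
    have h1 := hminus w hw
    have h2 := abs_le.1 (hJadd v w)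
    rw [energy_eq hh, norm_sq_sub_weightForm_add hh hv]
    linarith
  · refine tendstoAtInfty_of_quadratic (C := C) hη fun u hu => ?_
    have h1 := hplus u hu
    have h2 := abs_le.1 (hJ0 u)
    rw [energy_eq hh]
    linarith
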